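/- Let $\mathbb T$ be the unit circle in $\mathbb C$, let $L^2=L^2(\mathbb T)$ (with respect to normalized arc length), let $P_+$ be the orthogonal projection of $L^2$ onto the Hardy space $H^2$, that is, onto the closed linear span of $\{z^n : n\ge 0\}$, and let $P_-=I-P_+$. For continuous functions $f,g,\phi,\psi\in C(\mathbb T)$ put $$H=\begin{pmatrix} f&\phi\\ g&\psi\end{pmatrix}\in C(\mathbb T)_{2\times 2}$$ and let $R_H$ be the generalized singular integral operator on $L^2$ with symbol $H$, the bounded operator $$R_Hx=P_+fP_+x+P_-gP_+x+P_+\phi P_-x+P_-\psi P_-x,\qquad x\in L^2 .$$ For an invertible function $u\in C(\mathbb T)$, let $\sharp(u)=\frac1{2\pi i}\int_{u(\mathbb T)}\frac{dz}{z}$ be the winding number about the origin of the closed curve $\theta\mapsto u(e^{i\theta})$, $0\le\theta\le 2\pi$, the integral along this continuous curve being taken through local primitives of $dz/z$. Then $R_H$ is invertible as a bounded operator on $L^2$ if and only if the following three conditions hold: 1. $f$ and $\psi$ are invertible in $C(\mathbb T)$; 2. $\sharp(\psi)=\sharp(f)$; 3. $\operatorname{Ker}(R_H)=\{0\}$ or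 $\operatorname{Ker}(R_H^*)=\{0\}$ (or both). -/

import Mathlib

open MeasureTheory Set Filter Topology
open scoped ENNReal

namespace GSIO

/-- The unit circle, parametrised by the angle: the class of `θ` in `ℝ / 2πℤ` stands for the point
`z = exp (iθ)`. -/
abbrev 𝕋 : Type := AddCircle (2 * Real.pi)

instance fact_two_pi_pos : Fact (0 < 2 * Real.pi) := ⟨Real.two_pi_pos⟩

/-- `L²(𝕋)` with respect to normalised arc length `dθ / 2π`. -/
noncomputable abbrev L2 : Type := Lp ℂ 2 (AddCircle.haarAddCircle : Measure 𝕋)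

/-- The Hardy space `H²`, as a closed subspace of `L²(𝕋)`: the closed linear span of the monomials
`z ^ n`, `n ≥ 0` (the function `fourier n` is `θ ↦ exp (inθ)`). -/
noncomputable def hardy : Submodule ℂ L2 :=
  (Submodule.span ℂ (Set.range fun n : ℕ => (fourierLp 2 (n : ℤ) : L2))).topologicalClosure

noncomputable instance : CompleteSpace hardy :=
  inferInstanceAs (CompleteSpace (Submodule.topologicalClosure _))

/-- The Riesz projection: the orthogonal projection of `L²(𝕋)` onto `H²`. -/
noncomputable def Pplus : L2 →L[ℂ] L2 := hardy.starProjection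

/-- The complementary projection `P₋ = I - P₊`. -/
noncomputable def Pminus : L2 →L[ℂ] L2 := ContinuousLinearMap.id ℂ L2 - Pplus

/-- Multiplication by the continuous function `f` on `L²(𝕋)`. -/
noncomputable def mulOp (f : C(𝕋, ℂ)) : L2 →L[ℂ] L2 :=
  (ContinuousLinearMap.mul ℂ ℂ).holderL AddCircle.haarAddCircle ∞ 2 2
    (ContinuousMap.toLp ∞ AddCircle.haarAddCircle ℂ f)

theorem coeFn_mulOp (f : C(𝕋, ℂ)) (x : L2) :
    mulOp f x =ᵐ[AddCircle.haarAddCircle] fun t => f t * x t := by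
  have h := (ContinuousLinearMap.mul ℂ ℂ).coeFn_holder (r := 2)
    (ContinuousMap.toLp ∞ AddCircle.haarAddCircle ℂ f) x
  filter_upwards [h, ContinuousMap.coeFn_toLp (p := ∞) (𝕜 := ℂ) AddCircle.haarAddCircle f]
    with t h1 h2
  have h3 : mulOp f x t = (ContinuousLinearMap.mul ℂ ℂ)
    ((ContinuousMap.toLp ∞ AddCircle.haarAddCircle ℂ f) t) (x t) := h1
  rw [h3, h2]
  rfl

/-- The generalized singular integral operator with symbol `H = !![f, φ; g, ψ]`:
`R_H x = P₊ f P₊ x + P₋ g P₊ x + P₊ φ P₋ x + P₋ ψ P₋ x`. -/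
noncomputable def R (H : Matrix (Fin 2) (Fin 2) C(𝕋, ℂ)) : L2 →L[ℂ] L2 :=
  Pplus ∘L mulOp (H 0 0) ∘L Pplus + Pminus ∘L mulOp (H 1 0) ∘L Pplus
    + Pplus ∘L mulOp (H 0 1) ∘L Pminus + Pminus ∘L mulOp (H 1 1) ∘L Pminus

/-- `F` is a primitive of the form `h(z) dz` along the curve `γ : [a, b] → ℂ`: near each parameter
`t`, it is `G ∘ γ` for a holomorphic primitive `G` of `h` in a neighbourhood of `γ t`. -/
def IsPrimitiveAlong (h : ℂ → ℂ) (γ : ℝ → ℂ) (a b : ℝ) (F : ℝ → ℂ) : Prop :=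
  ∀ t ∈ Icc a b, ∃ G : ℂ → ℂ, (∀ᶠ z in 𝓝 (γ t), HasDerivAt G (h z) z) ∧
    ∀ᶠ s in 𝓝[Icc a b] t, F s = G (γ s)

open Classical in
/-- The integral of `h(z) dz` along a merely continuous curve `γ : [a, b] → ℂ`: the increment of a
primitive along the curve (`0` if there is none). -/
noncomputable def contourIntegral (h : ℂ → ℂ) (γ : ℝ → ℂ) (a b : ℝ) : ℂ :=
  if hF : ∃ F, IsPrimitiveAlong h γ a b F then hF.choose b - hF.choose a else 0

/-- The winding number about the origin of the closed curve `θ ↦ f (exp (iθ))`, `0 ≤ θ ≤ 2π`: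
`(1 / 2πi) ∫ dz / z` along this curve. -/
noncomputable def windingNumber (f : C(𝕋, ℂ)) : ℂ :=
  1 / (2 * Real.pi * Complex.I) *
    contourIntegral (fun z => 1 / z) (fun θ => f (θ : 𝕋)) 0 (2 * Real.pi)

/-- The increment does not depend on the primitive. -/
theorem IsPrimitiveAlong.contourIntegral_eq {h : ℂ → ℂ} {γ : ℝ → ℂ} {a b : ℝ} {F : ℝ → ℂ}
    (hab : a ≤ b) (hγ : ContinuousOn γ (Icc a b)) (hF : IsPrimitiveAlong h γ a b F) :
    contourIntegral h γ a b = F b - F a := by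
  have hex : ∃ F, IsPrimitiveAlong h γ a b F := ⟨F, hF⟩
  rw [contourIntegral, dif_pos hex]
  have hF' := hex.choose_spec
  set F' := hex.choose
  have key : ∀ t ∈ Icc a b, ∀ᶠ s in 𝓝[Icc a b] t, (F' - F) s = (F' - F) t := by
    intro t ht
    obtain ⟨G, hG, hFG⟩ := hF t ht
    obtain ⟨G', hG', hFG'⟩ := hF' t ht
    obtain ⟨r, hr, hball⟩ := Metric.eventually_nhds_iff_ball.1 (hG.and hG')
    have hconst : ∀ z ∈ Metric.ball (γ t) r, (G' - G) z = (G' - G) (γ t) := by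
      intro z hz
      refine Metric.isOpen_ball.is_const_of_deriv_eq_zero (f := G' - G)
        (convex_ball (γ t) r).isPreconnected (fun w hw => ?_) (fun w hw => ?_) hz
        (Metric.mem_ball_self hr)
      · exact ((hball w hw).2.sub (hball w hw).1).differentiableAt.differentiableWithinAt
      · simpa using ((hball w hw).2.sub (hball w hw).1).deriv
    have hnear : ∀ᶠ s in 𝓝[Icc a b] t, γ s ∈ Metric.ball (γ t) r :=
      (hγ t ht).eventually (Metric.ball_mem_nhds _ hr)
    have e1 := hFG.self_of_nhdsWithin ht
    have e2 := hFG'.self_of_nhdsWithin ht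
    filter_upwards [hFG, hFG', hnear] with s h1 h2 h3
    have := hconst _ h3
    simp only [Pi.sub_apply] at this ⊢
    rw [h1, h2, e1, e2, this]
  have hc : ∀ x ∈ Icc a b, ∀ y ∈ Icc a b, (F' - F) x = (F' - F) y := by
    intro x hx y hy
    refine @IsPreconnected.constant ℝ _ ℂ ⊥ (@DiscreteTopology.mk ℂ ⊥ rfl) (Icc a b)
      isPreconnected_Icc (F' - F) (fun t ht => ?_) x y hx hy
    refine Tendsto.mono_right ?_ (@pure_le_nhds ℂ ⊥ ((F' - F) t))
    exact tendsto_pure.2 (key t ht)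
  have h0 := hc a (left_mem_Icc.2 hab) b (right_mem_Icc.2 hab)
  simp only [Pi.sub_apply] at h0
  linear_combination -h0

/-- A continuous branch of `log γ` is a primitive of `dz / z` along `γ`. -/
theorem isPrimitiveAlong_of_exp {γ L : ℝ → ℂ} {a b : ℝ} (hL : ContinuousOn L (Icc a b))
    (hexp : ∀ t ∈ Icc a b, Complex.exp (L t) = γ t) :
    IsPrimitiveAlong (fun z => 1 / z) γ a b L := by
  intro t ht
  have hne : γ t ≠ 0 := hexp t ht ▸ Complex.exp_ne_zero _
  refine ⟨fun z => L t + Complex.log (z / γ t), ?_, ?_⟩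
  · have hc : ContinuousAt (fun z => z / γ t) (γ t) := by fun_prop
    have hs : ∀ᶠ z in 𝓝 (γ t), z / γ t ∈ Complex.slitPlane := by
      apply hc.eventually_mem
      rw [div_self hne]
      exact Complex.isOpen_slitPlane.mem_nhds Complex.one_mem_slitPlane
    filter_upwards [hs, isOpen_ne.mem_nhds hne] with z hz hz0
    have hz0 : z ≠ 0 := hz0
    have hd : HasDerivAt (fun z => L t + Complex.log (z / γ t)) (1 / γ t / (z / γ t)) z :=
      (((hasDerivAt_id z).div_const (γ t)).clog hz).const_add (L t)
    have e : 1 / γ t / (z / γ t) = 1 / z := by field_simp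
    rw [e] at hd
    exact hd
  · have hcont : Tendsto (fun s => (L s - L t).im) (𝓝[Icc a b] t) (𝓝 0) := by
      have h1 : ContinuousWithinAt (fun s => (L s - L t).im) (Icc a b) t :=
        Complex.continuous_im.continuousAt.comp_continuousWithinAt
          ((hL t ht).sub continuousWithinAt_const)
      simpa [ContinuousWithinAt] using h1
    have hnear := hcont.eventually (Ioo_mem_nhds (neg_lt_zero.2 Real.pi_pos) Real.pi_pos)
    filter_upwards [hnear, self_mem_nhdsWithin] with s hs hsI
    rw [← hexp s hsI, ← hexp t ht, ← Complex.exp_sub, Complex.log_exp hs.1 hs.2.le]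
    ring

end GSIO

namespace GSIO

/-! Commutators of `Pplus` with continuous functions are compact, so modulo compact operators `R H`
is `sio f ψ` = `f P₊ + ψ P₋`, and `g`, `φ` play no role. The Fredholm index is replaced by `IsWeyl`
(invertible plus compact): a class stable under products and compact perturbations, in which
injectivity already gives invertibility (`IsWeyl.isUnit`).

If `f = z^m e^a` and `ψ = z^n e^b`, with `m`, `n` the winding numbers, then modulo compacts `sio f
ψ` is `z^n · sio (z^(m-n)) 1 · sio (e^a) (e^b)`. The last factor is always Weyl, while `sio (z^k) 1`
is a one-sided shift, Weyl only for `k = 0`. Hence `R H` is Weyl exactly when the winding numbers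
agree (`isWeyl_sio_iff`). A trivial kernel of `R H`, or of its adjoint (an operator of the same
form), then gives invertibility.

That invertibility forces `f` and `ψ` to have no zeros is separate: on `z^n x` with `n → ∞`, `R H`
acts asymptotically as multiplication by `f`, and with `n → -∞` as multiplication by `ψ`. These
multiplications are therefore bounded below. -/

/-! ### Multiplication operators -/

/-- `mulOp` as a continuous linear map of the symbol. -/
noncomputable def mulOpL : C(𝕋, ℂ) →L[ℂ] (L2 →L[ℂ] L2) :=
  ((ContinuousLinearMap.mul ℂ ℂ).holderL AddCircle.haarAddCircle ∞ 2 2) ∘L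
    (ContinuousMap.toLp ∞ AddCircle.haarAddCircle ℂ)

theorem mulOp_sub (f g : C(𝕋, ℂ)) : mulOp (f - g) = mulOp f - mulOp g := map_sub mulOpL f g

theorem mulOp_one : mulOp 1 = 1 := by
  ext x
  filter_upwards [coeFn_mulOp 1 x] with t ht
  simp [ht]

theorem mulOp_mul (f g : C(𝕋, ℂ)) : mulOp (f * g) = mulOp f * mulOp g := by
  ext x
  rw [mul_apply_eq_comp]
  filter_upwards [coeFn_mulOp (f * g) x, coeFn_mulOp f (mulOp g x), coeFn_mulOp g x]
    with t h1 h2 h3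
  rw [h1, h2, h3, ContinuousMap.mul_apply, mul_assoc]

theorem isUnit_mulOp {f : C(𝕋, ℂ)} (hf : IsUnit f) : IsUnit (mulOp f) :=
  hf.map (⟨⟨mulOp, mulOp_one⟩, mulOp_mul⟩ : C(𝕋, ℂ) →* (L2 →L[ℂ] L2))

theorem adjoint_mulOp (f : C(𝕋, ℂ)) : ContinuousLinearMap.adjoint (mulOp f) = mulOp (star f) := by
  symm
  rw [ContinuousLinearMap.eq_adjoint_iff]
  intro x y
  rw [L2.inner_def, L2.inner_def]
  refine integral_congr_ae ?_
  filter_upwards [coeFn_mulOp (star f) x, coeFn_mulOp f y] with t h1 h2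
  rw [h1, h2]
  simp [mul_comm, mul_left_comm]

theorem mulOp_toLp (f g : C(𝕋, ℂ)) :
    mulOp f (ContinuousMap.toLp 2 AddCircle.haarAddCircle ℂ g) =
      ContinuousMap.toLp 2 AddCircle.haarAddCircle ℂ (f * g) := by
  ext
  filter_upwards [coeFn_mulOp f (ContinuousMap.toLp 2 AddCircle.haarAddCircle ℂ g),
    ContinuousMap.coeFn_toLp (p := 2) (𝕜 := ℂ) AddCircle.haarAddCircle g,
    ContinuousMap.coeFn_toLp (p := 2) (𝕜 := ℂ) AddCircle.haarAddCircle (f * g)] with t h1 h2 h3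
  rw [h1, h2, h3, ContinuousMap.mul_apply]

theorem fourier_mul_fourier (m n : ℤ) :
    (fourier m * fourier n : C(𝕋, ℂ)) = fourier (m + n) := by
  ext t; rw [ContinuousMap.mul_apply, fourier_add]

theorem fourier_zero_eq_one : (fourier 0 : C(𝕋, ℂ)) = 1 := by
  ext t; simp

theorem isUnit_fourier (m : ℤ) : IsUnit (fourier m : C(𝕋, ℂ)) :=
  IsUnit.of_mul_eq_one (fourier (-m))
    (by rw [fourier_mul_fourier, add_neg_cancel, fourier_zero_eq_one])

theorem mulOp_fourierLp (m n : ℤ) :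
    mulOp (fourier m) (fourierLp 2 n : L2) = fourierLp 2 (m + n) := by
  rw [mulOp_toLp, fourier_mul_fourier]

theorem norm_mulOp_fourier_apply (m : ℤ) (x : L2) : ‖mulOp (fourier m) x‖ = ‖x‖ := by
  rw [Lp.norm_def, Lp.norm_def]
  congr 1
  refine eLpNorm_congr_norm_ae ?_
  filter_upwards [coeFn_mulOp (fourier m) x] with t ht
  rw [ht, norm_mul, fourier_apply, Circle.norm_coe, one_mul]

/-! ### The Riesz projection -/

theorem Pplus_mul_self : Pplus * Pplus = Pplus := hardy.isIdempotentElem_starProjection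

theorem Pminus_eq : Pminus = 1 - Pplus := rfl

theorem adjoint_Pplus : ContinuousLinearMap.adjoint Pplus = Pplus :=
  isSelfAdjoint_starProjection hardy

theorem adjoint_Pminus : ContinuousLinearMap.adjoint Pminus = Pminus := by
  rw [Pminus_eq, map_sub, adjoint_Pplus]
  congr 1
  exact IsSelfAdjoint.one (L2 →L[ℂ] L2)

theorem Pplus_fourierLp_of_nonneg {n : ℤ} (hn : 0 ≤ n) :
    Pplus (fourierLp 2 n : L2) = fourierLp 2 n := by
  refine Submodule.starProjection_eq_self_iff.2 ?_
  refine Submodule.le_topologicalClosure _ (Submodule.subset_span ⟨n.toNat, ?_⟩)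
  simp only [Int.toNat_of_nonneg hn]

theorem Pplus_fourierLp_of_neg {n : ℤ} (hn : n < 0) : Pplus (fourierLp 2 n : L2) = 0 := by
  refine (Submodule.starProjection_apply_eq_zero_iff hardy).2 ?_
  rw [hardy, Submodule.orthogonal_closure]
  rw [Submodule.mem_orthogonal]
  intro u hu
  induction hu using Submodule.span_induction with
  | mem u hu =>
    obtain ⟨k, rfl⟩ := hu
    exact orthonormal_fourier.2 (by omega)
  | zero => simp
  | add u v _ _ hu hv => rw [inner_add_left, hu, hv, add_zero]
  | smul c u _ hu => rw [inner_smul_left, hu, mul_zero]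

theorem Pplus_fourierLp (n : ℤ) :
    Pplus (fourierLp 2 n : L2) = if 0 ≤ n then fourierLp 2 n else 0 := by
  split_ifs with h
  · exact Pplus_fourierLp_of_nonneg h
  · exact Pplus_fourierLp_of_neg (not_le.1 h)

theorem ext_fourierLp {S T : L2 →L[ℂ] L2}
    (h : ∀ n : ℤ, S (fourierLp 2 n) = T (fourierLp 2 n)) : S = T := by
  refine ContinuousLinearMap.ext_on (s := range (fourierLp 2 : ℤ → L2)) ?_ ?_
  · rw [dense_iff_closure_eq, ← Submodule.topologicalClosure_coe,
      span_fourierLp_closure_eq_top (by simp)]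
    rfl
  · rintro _ ⟨n, rfl⟩
    exact h n

/-! ### Compactness of commutators -/

theorem isCompactOperator_mul_left {K : L2 →L[ℂ] L2} (T : L2 →L[ℂ] L2) (hK : IsCompactOperator K) :
    IsCompactOperator (T * K) := hK.clm_comp T

theorem isCompactOperator_mul_right {K : L2 →L[ℂ] L2} (hK : IsCompactOperator K)
    (T : L2 →L[ℂ] L2) : IsCompactOperator (K * T) := hK.comp_clm T

theorem isCompactOperator_rankOne (x y : L2) :
    IsCompactOperator (InnerProductSpace.rankOne ℂ x y : L2 →L[ℂ] L2) := by
  have h : IsCompactOperator (innerSL ℂ y : L2 →L[ℂ] ℂ) :=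
    isCompactOperator_of_locallyCompactSpace_dom (innerSL ℂ y)
  exact h.clm_comp (ContinuousLinearMap.toSpanSingleton ℂ x)

/-- The commutator `P₊ f - f P₊`. -/
noncomputable def comm : C(𝕋, ℂ) →L[ℂ] (L2 →L[ℂ] L2) :=
  (ContinuousLinearMap.mul ℂ (L2 →L[ℂ] L2) Pplus -
    (ContinuousLinearMap.mul ℂ (L2 →L[ℂ] L2)).flip Pplus) ∘L mulOpL

theorem comm_apply (f : C(𝕋, ℂ)) : comm f = Pplus * mulOp f - mulOp f * Pplus := rfl

/-- This Leibniz rule reduces compactness for all powers of `z` to `z` and `z⁻¹`. -/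
theorem comm_mul (f g : C(𝕋, ℂ)) : comm (f * g) = comm f * mulOp g + mulOp f * comm g := by
  simp only [comm_apply, mulOp_mul]
  noncomm_ring

/-- Multiplication by `z` moves only the frequency `-1` across the boundary between negative and
nonnegative frequencies. -/
theorem comm_fourier_one :
    comm (fourier 1) =
      InnerProductSpace.rankOne ℂ (fourierLp 2 0 : L2) (fourierLp 2 (-1) : L2) := by
  refine ext_fourierLp fun n => ?_
  rw [comm_apply, InnerProductSpace.rankOne_apply, orthonormal_iff_ite.1 orthonormal_fourier]
  simp only [sub_apply, mul_apply_eq_comp, mulOp_fourierLp, Pplus_fourierLp]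
  rcases lt_trichotomy n (-1) with h | rfl | h
  · rw [if_neg (by omega), if_neg (by omega), if_neg (by omega)]; simp
  · simp
  · rw [if_pos (by omega), if_pos (by omega), if_neg (by omega), mulOp_fourierLp]; simp

theorem comm_fourier_neg_one :
    comm (fourier (-1)) =
      -InnerProductSpace.rankOne ℂ (fourierLp 2 (-1) : L2) (fourierLp 2 0 : L2) := by
  refine ext_fourierLp fun n => ?_
  rw [comm_apply, neg_apply, InnerProductSpace.rankOne_apply,
    orthonormal_iff_ite.1 orthonormal_fourier]
  simp only [sub_apply, mul_apply_eq_comp, mulOp_fourierLp, Pplus_fourierLp]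
  rcases lt_trichotomy n 0 with h | rfl | h
  · rw [if_neg (by omega), if_neg (by omega), if_neg (by omega)]; simp
  · simp [mulOp_fourierLp]
  · rw [if_pos (by omega), if_pos (by omega), if_neg (by omega), mulOp_fourierLp]; simp

theorem isCompactOperator_comm_mul {f g : C(𝕋, ℂ)} (hf : IsCompactOperator (comm f))
    (hg : IsCompactOperator (comm g)) : IsCompactOperator (comm (f * g)) := by
  rw [comm_mul]
  exact (isCompactOperator_mul_right hf _).add (isCompactOperator_mul_left _ hg)

theorem isCompactOperator_comm_fourier (n : ℤ) : IsCompactOperator (comm (fourier n)) := by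
  induction n using Int.induction_on with
  | zero =>
    rw [fourier_zero_eq_one, comm_apply, mulOp_one, mul_one, one_mul, sub_self]
    exact isCompactOperator_zero
  | succ n ih =>
    rw [← fourier_mul_fourier]
    refine isCompactOperator_comm_mul ih ?_
    rw [comm_fourier_one]
    exact isCompactOperator_rankOne _ _
  | pred n ih =>
    rw [sub_eq_add_neg, ← fourier_mul_fourier]
    refine isCompactOperator_comm_mul ih ?_
    rw [comm_fourier_neg_one]
    exact (isCompactOperator_rankOne _ _).neg

/-- The commutator of the Riesz projection with a continuous function is compact. -/
theorem isCompactOperator_comm (f : C(𝕋, ℂ)) : IsCompactOperator (comm f) := by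
  -- Compact operators are norm closed and `comm` is continuous, so the dense trigonometric
  -- polynomials suffice.
  have hcl : IsClosed {f : C(𝕋, ℂ) | IsCompactOperator (comm f)} :=
    isClosed_setOfPred_isCompactOperator.preimage comm.continuous
  have hsub : (Submodule.span ℂ (range (@fourier (2 * Real.pi)))).topologicalClosure ≤
      (compactOperator (RingHom.id ℂ) L2 L2).comap comm.toLinearMap := by
    refine Submodule.topologicalClosure_minimal _ (Submodule.span_le.2 ?_) hcl
    rintro _ ⟨n, rfl⟩
    exact isCompactOperator_comm_fourier n
  rw [span_fourier_closure_eq_top] at hsub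
  exact hsub (Submodule.mem_top (x := f))

/-! ### Compact perturbations of invertible operators -/

/-- `T` is a compact perturbation of an invertible operator. -/
def IsWeyl (T : L2 →L[ℂ] L2) : Prop :=
  ∃ U : (L2 →L[ℂ] L2)ˣ, IsCompactOperator (T - U : L2 →L[ℂ] L2)

theorem isWeyl_of_isUnit {T : L2 →L[ℂ] L2} (hT : IsUnit T) : IsWeyl T := by
  obtain ⟨U, rfl⟩ := hT
  refine ⟨U, ?_⟩
  rw [sub_self]
  exact isCompactOperator_zero

theorem IsWeyl.congr {S T : L2 →L[ℂ] L2} (hS : IsWeyl S)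
    (h : IsCompactOperator (T - S : L2 →L[ℂ] L2)) : IsWeyl T := by
  obtain ⟨U, hU⟩ := hS
  refine ⟨U, ?_⟩
  have := h.add hU
  rwa [← FunLike.coe_add, sub_add_sub_cancel] at this

theorem IsWeyl.mul {S T : L2 →L[ℂ] L2} (hS : IsWeyl S) (hT : IsWeyl T) : IsWeyl (S * T) := by
  obtain ⟨U, hU⟩ := hS
  obtain ⟨V, hV⟩ := hT
  refine ⟨U * V, ?_⟩
  have := (isCompactOperator_mul_right hU T).add
    (isCompactOperator_mul_left (U : L2 →L[ℂ] L2) hV)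
  rw [← FunLike.coe_add] at this
  have e : S * T - ↑(U * V) = (S - U) * T + U * (T - V) := by
    rw [Units.val_mul]
    noncomm_ring
  rwa [e]

theorem IsWeyl.of_mul_left {S T : L2 →L[ℂ] L2} (hST : IsWeyl (S * T)) (hS : IsUnit S) :
    IsWeyl T := by
  obtain ⟨U, rfl⟩ := hS
  have := (isWeyl_of_isUnit (U⁻¹).isUnit).mul hST
  rwa [Units.inv_mul_cancel_left] at this

/-- Modulo compacts `T` may be replaced by an invertible `V`, which can then be cancelled. -/
theorem IsWeyl.of_mul_right {S T : L2 →L[ℂ] L2} (hST : IsWeyl (S * T)) (hT : IsWeyl T) :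
    IsWeyl S := by
  obtain ⟨V, hV⟩ := hT
  have h : IsWeyl (S * V) := by
    refine hST.congr ?_
    have := (isCompactOperator_mul_left S hV).neg
    rw [← FunLike.coe_neg] at this
    have e : S * V - S * T = -(S * (T - V)) := by noncomm_ring
    rwa [e]
  have := h.mul (isWeyl_of_isUnit (V⁻¹).isUnit)
  rwa [Units.mul_inv_cancel_right] at this

/-- A right inverse of a compact perturbation of an invertible operator is one too. -/
theorem IsWeyl.of_mul_eq_one {S T : L2 →L[ℂ] L2} (hS : IsWeyl S) (h : S * T = 1) : IsWeyl T := by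
  obtain ⟨U, hU⟩ := hS
  refine ⟨U⁻¹, ?_⟩
  have := (isCompactOperator_mul_left (↑U⁻¹ : L2 →L[ℂ] L2)
    (isCompactOperator_mul_right hU T)).neg
  rw [← FunLike.coe_neg] at this
  have e : T - ↑U⁻¹ = -(↑U⁻¹ * ((S - U) * T)) := by
    rw [sub_mul, h, mul_sub, Units.inv_mul_cancel_left]
    noncomm_ring
  rwa [e]

/-- The Fredholm alternative. -/
theorem IsWeyl.isUnit {T : L2 →L[ℂ] L2} (hT : IsWeyl T) (hinj : Function.Injective T) :
    IsUnit T := by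
  obtain ⟨U, hU⟩ := hT
  -- Since `T = U (1 - K)` with `K` compact, the question is whether `1` is an eigenvalue of `K`; an
  -- eigenvector would lie in the kernel of `T`.
  set K : L2 →L[ℂ] L2 := ↑U⁻¹ * (U - T) with hKdef
  have hK : IsCompactOperator K := by
    have := (isCompactOperator_mul_left (↑U⁻¹ : L2 →L[ℂ] L2) hU).neg
    rw [← FunLike.coe_neg] at this
    have e : K = -(↑U⁻¹ * (T - U)) := by
      rw [hKdef]
      noncomm_ring
    rwa [e]
  have hUK : ↑U * (1 - K) = T := by
    rw [hKdef, mul_sub, Units.mul_inv_cancel_left]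
    noncomm_ring
  rcases hK.hasEigenvalue_or_mem_resolventSet one_ne_zero with h | h
  · obtain ⟨x, hx, hx0⟩ := h.exists_hasEigenvector
    rw [Module.End.mem_eigenspace_iff, one_smul] at hx
    refine absurd (hinj (a₁ := x) (a₂ := 0) ?_) hx0
    have hx' : K x = x := hx
    rw [← hUK, map_zero, mul_apply_eq_comp, sub_apply, hx']
    simp
  · rw [spectrum.mem_resolventSet_iff, map_one] at h
    rw [← hUK]
    exact U.isUnit.mul h

/-! ### The operators `f P₊ + ψ P₋` -/

/-- The singular integral operator `f P₊ + ψ P₋`. -/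
noncomputable def sio (f ψ : C(𝕋, ℂ)) : L2 →L[ℂ] L2 := mulOp f * Pplus + mulOp ψ * Pminus

/-- On the range of `P₊`, `P₊ f = f + comm f` and `P₋ g = -comm g`; similarly on the range of `P₋`.
-/
theorem R_sub_sio (f g φ ψ : C(𝕋, ℂ)) :
    R !![f, φ; g, ψ] - sio f ψ = comm (f - g) * Pplus + comm (φ - ψ) * Pminus := by
  have h1 : R !![f, φ; g, ψ] = Pplus * mulOp f * Pplus + Pminus * mulOp g * Pplus
    + Pplus * mulOp φ * Pminus + Pminus * mulOp ψ * Pminus := rfl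
  have hP : ∀ T, T * Pplus * Pplus = T * Pplus := fun T => by rw [mul_assoc, Pplus_mul_self]
  rw [h1, sio, Pminus_eq, map_sub, map_sub]
  simp only [comm_apply, mul_sub, sub_mul, mul_one, one_mul, hP]
  abel

theorem isCompactOperator_R_sub_sio (f g φ ψ : C(𝕋, ℂ)) :
    IsCompactOperator (R !![f, φ; g, ψ] - sio f ψ : L2 →L[ℂ] L2) := by
  rw [R_sub_sio]
  exact (isCompactOperator_mul_right (isCompactOperator_comm _) _).add
    (isCompactOperator_mul_right (isCompactOperator_comm _) _)

theorem sio_mul_sio_sub (f₁ ψ₁ f₂ ψ₂ : C(𝕋, ℂ)) :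
    sio f₁ ψ₁ * sio f₂ ψ₂ - sio (f₁ * f₂) (ψ₁ * ψ₂) =
      mulOp (f₁ - ψ₁) * (comm f₂ * Pplus + comm ψ₂ * Pminus) := by
  have hP : ∀ T, T * Pplus * Pplus = T * Pplus := fun T => by rw [mul_assoc, Pplus_mul_self]
  simp only [sio, Pminus_eq, mulOp_mul, mulOp_sub, comm_apply, mul_sub, sub_mul, mul_add, add_mul,
    mul_one, ← mul_assoc, hP]
  abel

theorem isCompactOperator_sio_mul_sio_sub (f₁ ψ₁ f₂ ψ₂ : C(𝕋, ℂ)) :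
    IsCompactOperator (sio f₁ ψ₁ * sio f₂ ψ₂ - sio (f₁ * f₂) (ψ₁ * ψ₂) : L2 →L[ℂ] L2) := by
  rw [sio_mul_sio_sub]
  exact isCompactOperator_mul_left _
    ((isCompactOperator_mul_right (isCompactOperator_comm _) _).add
      (isCompactOperator_mul_right (isCompactOperator_comm _) _))

theorem IsWeyl.sio_mul {f₁ ψ₁ f₂ ψ₂ : C(𝕋, ℂ)} (h₁ : IsWeyl (sio f₁ ψ₁))
    (h₂ : IsWeyl (sio f₂ ψ₂)) : IsWeyl (sio (f₁ * f₂) (ψ₁ * ψ₂)) := by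
  refine (h₁.mul h₂).congr ?_
  have := (isCompactOperator_sio_mul_sio_sub f₁ ψ₁ f₂ ψ₂).neg
  rwa [← FunLike.coe_neg, neg_sub] at this

theorem sio_one_one : sio 1 1 = 1 := by
  rw [sio, mulOp_one, Pminus_eq]; simp

theorem IsWeyl.sio_pow {f ψ : C(𝕋, ℂ)} (h : IsWeyl (sio f ψ)) (n : ℕ) :
    IsWeyl (sio (f ^ n) (ψ ^ n)) := by
  induction n with
  | zero =>
    rw [pow_zero, pow_zero, sio_one_one]
    exact isWeyl_of_isUnit isUnit_one
  | succ n ih =>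
    rw [pow_succ, pow_succ]
    exact ih.sio_mul h

/-- For large `n` the operator with symbols `e^(a/n)`, `e^(b/n)` is close to the identity, hence
invertible; its `n`-th power has the required symbols modulo compacts. -/
theorem isWeyl_sio_exp (a b : C(𝕋, ℂ)) :
    IsWeyl (sio (NormedSpace.exp a) (NormedSpace.exp b)) := by
  have hc : Tendsto (fun n : ℕ => sio (NormedSpace.exp (((n : ℂ)⁻¹) • a))
      (NormedSpace.exp (((n : ℂ)⁻¹) • b))) atTop (𝓝 1) := by
    have hg : Continuous fun t : ℂ => sio (NormedSpace.exp (t • a)) (NormedSpace.exp (t • b)) := by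
      have he : ∀ c : C(𝕋, ℂ), Continuous fun t : ℂ => mulOpL (NormedSpace.exp (t • c)) :=
        fun c => mulOpL.continuous.comp
          ((NormedSpace.exp_continuous (𝔸 := C(𝕋, ℂ))).comp (continuous_id.smul continuous_const))
      exact ((he a).mul continuous_const).add ((he b).mul continuous_const)
    have h0 := hg.tendsto 0
    simp only [zero_smul, NormedSpace.exp_zero, sio_one_one] at h0
    exact h0.comp tendsto_inv_atTop_nhds_zero_nat
  have hu := hc.eventually (Units.isOpen.mem_nhds (isUnit_one : IsUnit (1 : L2 →L[ℂ] L2)))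
  obtain ⟨n, hn, hn0⟩ := (hu.and (eventually_ne_atTop 0)).exists
  have key : ∀ c : C(𝕋, ℂ), NormedSpace.exp (((n : ℂ)⁻¹) • c) ^ n = NormedSpace.exp c := by
    intro c
    rw [← NormedSpace.exp_nsmul, ← Nat.cast_smul_eq_nsmul ℂ, smul_smul,
      mul_inv_cancel₀ (Nat.cast_ne_zero.2 hn0), one_smul]
  have := (isWeyl_of_isUnit hn).sio_pow n
  rwa [key, key] at this

theorem sio_fourier_one_fourierLp (k n : ℤ) :
    sio (fourier k) 1 (fourierLp 2 n) = if 0 ≤ n then fourierLp 2 (k + n) else fourierLp 2 n := by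
  rw [sio, mulOp_one, Pminus_eq, one_mul, add_apply, mul_apply_eq_comp, sub_apply,
    Pplus_fourierLp]
  split_ifs with h
  · simp [mulOp_fourierLp]
  · simp

/-- Raising nonnegative frequencies by `k ≥ 0` keeps them nonnegative, so lowering them by `k`
undoes it. The opposite order fails for `k > 0`. -/
theorem sio_fourier_neg_mul (k : ℕ) :
    sio (fourier (-k : ℤ)) 1 * sio (fourier (k : ℤ)) 1 = 1 := by
  refine ext_fourierLp fun n => ?_
  rw [mul_apply_eq_comp, sio_fourier_one_fourierLp]
  split_ifs with h
  · rw [sio_fourier_one_fourierLp, if_pos (by omega), neg_add_cancel_left]; rfl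
  · rw [sio_fourier_one_fourierLp, if_neg h]; rfl

theorem not_isWeyl_sio_fourier_natCast {k : ℕ} (hk : k ≠ 0) :
    ¬ IsWeyl (sio (fourier (k : ℤ)) 1) := by
  intro h
  have hinv := sio_fourier_neg_mul k
  have hu : IsUnit (sio (fourier (k : ℤ)) 1) := by
    refine h.isUnit (Function.LeftInverse.injective (g := sio (fourier (-k : ℤ)) 1) fun x => ?_)
    rw [← mul_apply_eq_comp, hinv]
    rfl
  obtain ⟨U, hU⟩ := hu
  have hU' : sio (fourier (-k : ℤ)) 1 = ↑U⁻¹ := by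
    rw [← hU] at hinv
    exact (Units.mul_eq_one_iff_eq_inv.1 hinv)
  have hinj : Function.Injective (sio (fourier (-k : ℤ)) 1) := by
    rw [hU']
    refine Function.LeftInverse.injective (g := (U : L2 →L[ℂ] L2)) fun x => ?_
    rw [← mul_apply_eq_comp, Units.mul_inv]
    rfl
  -- The left inverse sends `z^0` and `z^(-k)` both to `z^(-k)`, so it cannot be injective.
  have h0 : (fourierLp 2 (0 : ℤ) : L2) = fourierLp 2 (-k : ℤ) := by
    apply hinj
    rw [sio_fourier_one_fourierLp, sio_fourier_one_fourierLp, if_pos le_rfl, if_neg (by omega),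
      add_zero]
  have := orthonormal_fourier.linearIndependent.injective h0
  omega

theorem not_isWeyl_sio_fourier {k : ℤ} (hk : k ≠ 0) : ¬ IsWeyl (sio (fourier k) 1) := by
  obtain ⟨n, rfl | rfl⟩ := k.eq_nat_or_neg
  · exact not_isWeyl_sio_fourier_natCast (by omega)
  · intro h
    exact not_isWeyl_sio_fourier_natCast (k := n) (by omega)
      (h.of_mul_eq_one (sio_fourier_neg_mul n))

theorem isWeyl_sio_iff (m n : ℤ) (a b : C(𝕋, ℂ)) :
    IsWeyl (sio (fourier m * NormedSpace.exp a) (fourier n * NormedSpace.exp b)) ↔ m = n := by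
  have hmn : sio (fourier m) (fourier n) = mulOp (fourier n) * sio (fourier (m - n)) 1 := by
    rw [sio, sio, mulOp_one, mul_add, ← mul_assoc, ← mulOp_mul, fourier_mul_fourier,
      add_sub_cancel, one_mul]
  constructor
  · intro h
    have h1 : IsWeyl (sio (fourier m) (fourier n)) :=
      (h.congr (isCompactOperator_sio_mul_sio_sub _ _ _ _)).of_mul_right (isWeyl_sio_exp a b)
    rw [hmn] at h1
    by_contra hne
    exact not_isWeyl_sio_fourier (sub_ne_zero.2 hne)
      (h1.of_mul_left (isUnit_mulOp (isUnit_fourier n)))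
  · rintro rfl
    refine IsWeyl.sio_mul ?_ (isWeyl_sio_exp a b)
    rw [hmn, sub_self, fourier_zero_eq_one, sio_one_one, mul_one]
    exact isWeyl_of_isUnit (isUnit_mulOp (isUnit_fourier m))

/-! ### Winding numbers -/

theorem exp_apply (a : C(𝕋, ℂ)) (t : 𝕋) : NormedSpace.exp a t = Complex.exp (a t) := by
  rw [Complex.exp_eq_exp_ℂ]
  exact NormedSpace.map_exp (ContinuousMap.evalAlgHom ℂ ℂ t) (continuous_eval_const t) a

/-- Paths lift through the covering `exp` of the punctured plane. -/
theorem exists_continuous_log {γ : C(ℝ, ℂ)} (h : ∀ t, γ t ≠ 0) :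
    ∃ L : C(ℝ, ℂ), ∀ t, Complex.exp (L t) = γ t := by
  obtain ⟨L, ⟨-, hL⟩, -⟩ := Complex.isCoveringMapOn_exp.existsUnique_continuousMap_lifts γ
    (a₀ := 0) (e₀ := Complex.log (γ 0)) (Complex.exp_log (h 0)) h
  exact ⟨L, fun t => congrFun hL t⟩

/-- A continuous function on the circle without zeros is `z ^ m * exp a`, where `m` is its winding
number. -/
theorem exists_eq_fourier_mul_exp {f : C(𝕋, ℂ)} (hf : IsUnit f) :
    ∃ (m : ℤ) (a : C(𝕋, ℂ)), f = fourier m * NormedSpace.exp a ∧ windingNumber f = m := by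
  have hf0 : ∀ t, f t ≠ 0 := ContinuousMap.isUnit_iff_forall_ne_zero f |>.1 hf
  obtain ⟨L, hL⟩ := exists_continuous_log (γ := f.comp ⟨fun θ : ℝ => (θ : 𝕋), by fun_prop⟩)
    fun t => hf0 _
  have hL' : ∀ θ : ℝ, Complex.exp (L θ) = f (θ : 𝕋) := hL
  obtain ⟨m, hm⟩ : ∃ m : ℤ, L (2 * Real.pi) = L 0 + m * (2 * Real.pi * Complex.I) := by
    rw [← Complex.exp_eq_exp_iff_exists_int, hL', hL', AddCircle.coe_period]
    rfl
  have hw : windingNumber f = m := by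
    have hγ : Continuous fun θ : ℝ => f (θ : 𝕋) :=
      f.continuous.comp (AddCircle.continuous_mk' _)
    rw [windingNumber, (isPrimitiveAlong_of_exp L.continuous.continuousOn
      fun t _ => hL' t).contourIntegral_eq Real.two_pi_pos.le hγ.continuousOn, hm]
    have := Complex.two_pi_I_ne_zero
    field_simp
    ring
  -- Removing `imθ` cancels the increment `2πim` of the logarithm, so the rest descends to the
  -- circle.
  let c : ℝ → ℂ := fun θ => L θ - m * θ * Complex.I
  have hc : Continuous c := by fun_prop
  have hc0 : c 0 = c (2 * Real.pi) := by
    simp only [c, hm]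
    push_cast
    ring
  let a : C(𝕋, ℂ) := ⟨AddCircle.liftIco (2 * Real.pi) 0 c,
    AddCircle.liftIco_zero_continuous hc0 hc.continuousOn⟩
  refine ⟨m, a, ContinuousMap.ext fun t => ?_, hw⟩
  obtain ⟨θ, hθ, rfl⟩ := AddCircle.eq_coe_Ico t
  have ha : a (θ : 𝕋) = c θ := AddCircle.liftIco_zero_coe_apply (f := c) hθ
  rw [ContinuousMap.mul_apply, exp_apply, ha, fourier_coe_apply, ← Complex.exp_add, ← hL']
  congr 1
  have : (Real.pi : ℂ) ≠ 0 := by exact_mod_cast Real.pi_ne_zero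
  simp only [c]
  push_cast
  field_simp
  ring

/-! ### Invertibility of the diagonal symbols -/

/-- For contractions, strong convergence to zero need only be checked on a dense subspace. -/
theorem tendsto_zero_of_fourierLp {T : ℕ → L2 →L[ℂ] L2} (hT : ∀ n x, ‖T n x‖ ≤ ‖x‖)
    (h : ∀ k : ℤ, ∀ᶠ n in atTop, T n (fourierLp 2 k) = 0) (x : L2) :
    Tendsto (fun n => T n x) atTop (𝓝 0) := by
  have hspan : ∀ y ∈ Submodule.span ℂ (range (fourierLp 2 : ℤ → L2)),
      ∀ᶠ n in atTop, T n y = 0 := by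
    intro y hy
    induction hy using Submodule.span_induction with
    | mem y hy =>
      obtain ⟨k, rfl⟩ := hy
      exact h k
    | zero => simp
    | add u v _ _ hu hv => filter_upwards [hu, hv] with n h1 h2; rw [map_add, h1, h2, add_zero]
    | smul c u _ hu => filter_upwards [hu] with n h1; rw [map_smul, h1, smul_zero]
  rw [Metric.tendsto_nhds]
  intro ε hε
  have hx : x ∈ (Submodule.span ℂ (range (fourierLp 2 : ℤ → L2))).topologicalClosure := by
    rw [span_fourierLp_closure_eq_top (by simp)]
    trivial
  obtain ⟨y, hy, hxy⟩ := Metric.mem_closure_iff.1 hx ε hε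
  filter_upwards [hspan y hy] with n hn
  rw [dist_zero_right]
  calc ‖T n x‖ = ‖T n (x - y)‖ := by rw [map_sub, hn, sub_zero]
    _ ≤ ‖x - y‖ := hT n _
    _ < ε := by rwa [← dist_eq_norm]

theorem norm_Pplus_apply_le (x : L2) : ‖Pplus x‖ ≤ ‖x‖ :=
  hardy.norm_starProjection_apply_le x

theorem norm_Pminus_apply_le (x : L2) : ‖Pminus x‖ ≤ ‖x‖ := by
  have h : Pminus = hardyᗮ.starProjection := hardy.starProjection_orthogonal'.symm
  rw [h]
  exact hardyᗮ.norm_starProjection_apply_le x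

theorem tendsto_Pminus_fourier (x : L2) :
    Tendsto (fun n : ℕ => Pminus (mulOp (fourier (n : ℤ)) x)) atTop (𝓝 0) := by
  refine tendsto_zero_of_fourierLp (T := fun n : ℕ => Pminus * mulOp (fourier (n : ℤ)))
    (fun n x => (norm_Pminus_apply_le _).trans_eq (norm_mulOp_fourier_apply _ _)) (fun k => ?_) x
  filter_upwards [eventually_ge_atTop k.natAbs] with n hn
  rw [mul_apply_eq_comp, mulOp_fourierLp, Pminus_eq, sub_apply,
    Pplus_fourierLp_of_nonneg (by omega)]
  simp

theorem tendsto_Pplus_fourier_neg (x : L2) :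
    Tendsto (fun n : ℕ => Pplus (mulOp (fourier (-n : ℤ)) x)) atTop (𝓝 0) := by
  refine tendsto_zero_of_fourierLp (T := fun n : ℕ => Pplus * mulOp (fourier (-n : ℤ)))
    (fun n x => (norm_Pplus_apply_le _).trans_eq (norm_mulOp_fourier_apply _ _)) (fun k => ?_) x
  filter_upwards [eventually_gt_atTop k.natAbs] with n hn
  rw [mul_apply_eq_comp, mulOp_fourierLp, Pplus_fourierLp_of_neg (by omega)]

theorem mulOp_comm_apply (f g : C(𝕋, ℂ)) (x : L2) :
    mulOp f (mulOp g x) = mulOp g (mulOp f x) := by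
  rw [← mul_apply_eq_comp, ← mulOp_mul, mul_comm f, mulOp_mul, mul_apply_eq_comp]

/-- If the translates `wₙ x` are asymptotically in the range of the projection `P`, then the block
operator with entries `f`, `g`, `φ`, `ψ` acts on them asymptotically as multiplication by `f`. -/
theorem tendsto_block_sub_mulOp {P Q : L2 →L[ℂ] L2} (hPQ : P + Q = 1) {w : ℕ → C(𝕋, ℂ)}
    (hQ : ∀ x, Tendsto (fun n => Q (mulOp (w n) x)) atTop (𝓝 0)) (f g φ ψ : C(𝕋, ℂ)) (x : L2) :
    Tendsto (fun n => (P * mulOp f * P + Q * mulOp g * P + P * mulOp φ * Q + Q * mulOp ψ * Q)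
      (mulOp (w n) x) - mulOp f (mulOp (w n) x)) atTop (𝓝 0) := by
  have hP : ∀ y, P y = y - Q y := fun y => by
    rw [eq_sub_iff_add_eq, ← add_apply, hPQ, one_apply_eq_self]
  have hT : ∀ T : L2 →L[ℂ] L2, Tendsto (fun n => T (Q (mulOp (w n) x))) atTop (𝓝 0) := fun T => by
    have := (T.continuous.tendsto 0).comp (hQ x)
    rwa [map_zero] at this
  have h := ((((hQ (mulOp g x)).sub (hQ (mulOp f x))).sub (hT (Q * mulOp g))).add
    (hT (P * mulOp φ + Q * mulOp ψ))).sub (hT (P * mulOp f))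
  simp only [sub_zero, add_zero] at h
  refine h.congr fun n => ?_
  -- With `P = 1 - Q`, each error term has `Q` either next to `w n x` or outermost; in the latter
  -- case `w n` is commuted past `f` or `g` so that `hQ` applies.
  rw [← mulOp_comm_apply g, ← mulOp_comm_apply f]
  simp only [add_apply, mul_apply_eq_comp, hP, map_sub]
  abel

/-- Multiplication by `z^(k n)` is isometric and commutes with `f`, so the lower bound for `A`
passes in the limit to `mulOp f`. -/
theorem norm_le_of_isUnit_block {P Q A : L2 →L[ℂ] L2} (hPQ : P + Q = 1) {k : ℕ → ℤ}
    (hQ : ∀ x, Tendsto (fun n => Q (mulOp (fourier (k n)) x)) atTop (𝓝 0)) {f g φ ψ : C(𝕋, ℂ)}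
    (hA : A = P * mulOp f * P + Q * mulOp g * P + P * mulOp φ * Q + Q * mulOp ψ * Q)
    (hu : IsUnit A) : ∃ C : ℝ, ∀ x, ‖x‖ ≤ C * ‖mulOp f x‖ := by
  obtain ⟨U, rfl⟩ := hu
  refine ⟨‖(↑U⁻¹ : L2 →L[ℂ] L2)‖, fun x => ?_⟩
  have h := tendsto_block_sub_mulOp hPQ hQ f g φ ψ x
  rw [← hA] at h
  have h2 : Tendsto (fun n => ‖(↑U⁻¹ : L2 →L[ℂ] L2)‖ * (‖(U : L2 →L[ℂ] L2)
      (mulOp (fourier (k n)) x) - mulOp f (mulOp (fourier (k n)) x)‖ + ‖mulOp f x‖)) atTop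
      (𝓝 (‖(↑U⁻¹ : L2 →L[ℂ] L2)‖ * (0 + ‖mulOp f x‖))) := by
    refine Tendsto.const_mul _ (Tendsto.add_const _ ?_)
    simpa using h.norm
  rw [zero_add] at h2
  refine ge_of_tendsto' h2 fun n => ?_
  set y := mulOp (fourier (k n)) x with hy
  have hfy : ‖mulOp f y‖ = ‖mulOp f x‖ := by
    rw [hy, mulOp_comm_apply, norm_mulOp_fourier_apply]
  have hUy : (↑U⁻¹ : L2 →L[ℂ] L2) ((U : L2 →L[ℂ] L2) y) = y := by
    rw [← mul_apply_eq_comp, Units.inv_mul, one_apply_eq_self]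
  calc ‖x‖ = ‖y‖ := (norm_mulOp_fourier_apply _ _).symm
    _ = ‖(↑U⁻¹ : L2 →L[ℂ] L2) ((U : L2 →L[ℂ] L2) y)‖ := by rw [hUy]
    _ ≤ ‖(↑U⁻¹ : L2 →L[ℂ] L2)‖ * ‖(U : L2 →L[ℂ] L2) y‖ := ContinuousLinearMap.le_opNorm _ _
    _ ≤ _ := by
      gcongr
      rw [← hfy]
      exact norm_le_norm_sub_add _ _

/-- A continuous function whose multiplication operator is bounded below has no zeros. -/
theorem isUnit_of_norm_le {f : C(𝕋, ℂ)} {C : ℝ} (h : ∀ x, ‖x‖ ≤ C * ‖mulOp f x‖) : IsUnit f := by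
  rw [ContinuousMap.isUnit_iff_forall_ne_zero]
  intro t₀ ht₀
  obtain ⟨ε, hε, hCε⟩ : ∃ ε : ℝ, 0 < ε ∧ C * ε < 1 := by
    refine ⟨(|C| + 1)⁻¹, by positivity, ?_⟩
    rw [← div_eq_mul_inv, div_lt_one (by positivity)]
    linarith [le_abs_self C]
  -- A bump equal to `ε` at the zero `t₀` and vanishing where `‖f‖ ≥ ε`: the bound would give `‖x‖ ≤
  -- C ε ‖x‖` with `C ε < 1`, forcing it to vanish.
  let b : C(𝕋, ℂ) := ⟨fun t => ((max 0 (ε - ‖f t‖) : ℝ) : ℂ), by fun_prop⟩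
  set x : L2 := ContinuousMap.toLp 2 AddCircle.haarAddCircle ℂ b with hx
  have hfx : ‖mulOp f x‖ ≤ ε * ‖x‖ := by
    refine Lp.norm_le_mul_norm_of_ae_le_mul ?_
    filter_upwards [coeFn_mulOp f x,
      ContinuousMap.coeFn_toLp (p := 2) (𝕜 := ℂ) AddCircle.haarAddCircle b] with t h1 h2
    rw [h1, norm_mul]
    rcases le_total ‖f t‖ ε with h3 | h3
    · gcongr
    · have : b t = 0 := by simp [b, h3]
      rw [hx, h2, this]
      simp
  have hx0 : x = 0 := by
    rw [← norm_eq_zero]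
    by_contra hne
    have hpos : 0 < ‖x‖ := lt_of_le_of_ne (norm_nonneg _) (Ne.symm hne)
    have h1 := h x
    rcases le_total C 0 with hC | hC
    · nlinarith [norm_nonneg (mulOp f x)]
    · nlinarith [mul_le_mul_of_nonneg_left hfx hC]
  have hb : b = 0 := by
    apply ContinuousMap.toLp_injective (p := 2) (𝕜 := ℂ) (AddCircle.haarAddCircle : Measure 𝕋)
    rw [map_zero]
    exact hx0
  have := DFunLike.congr_fun hb t₀
  simp [b, ht₀, hε.le, hε.ne'] at this

theorem R_eq (f g φ ψ : C(𝕋, ℂ)) :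
    R !![f, φ; g, ψ] = Pplus * mulOp f * Pplus + Pminus * mulOp g * Pplus
      + Pplus * mulOp φ * Pminus + Pminus * mulOp ψ * Pminus := rfl

theorem isUnit_left_of_isUnit_R {f g φ ψ : C(𝕋, ℂ)} (h : IsUnit (R !![f, φ; g, ψ])) :
    IsUnit f := by
  obtain ⟨C, hC⟩ := norm_le_of_isUnit_block (by rw [Pminus_eq]; abel) tendsto_Pminus_fourier
    (R_eq f g φ ψ) h
  exact isUnit_of_norm_le hC

theorem isUnit_right_of_isUnit_R {f g φ ψ : C(𝕋, ℂ)} (h : IsUnit (R !![f, φ; g, ψ])) :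
    IsUnit ψ := by
  -- The mirror image: the two projections are exchanged and the translates use `z^(-n)`.
  obtain ⟨C, hC⟩ := norm_le_of_isUnit_block (P := Pminus) (Q := Pplus) (f := ψ) (g := φ) (φ := g)
    (ψ := f) (by rw [Pminus_eq]; abel) tendsto_Pplus_fourier_neg
    (by rw [R_eq]; abel) h
  exact isUnit_of_norm_le hC

/-! ### The main theorem -/

theorem adjoint_R (f g φ ψ : C(𝕋, ℂ)) :
    ContinuousLinearMap.adjoint (R !![f, φ; g, ψ]) =
      R !![star f, star g; star φ, star ψ] := by
  rw [R_eq, R_eq]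
  have h : ∀ S T : L2 →L[ℂ] L2, ContinuousLinearMap.adjoint (S * T) =
    ContinuousLinearMap.adjoint T * ContinuousLinearMap.adjoint S :=
    ContinuousLinearMap.adjoint_comp
  simp only [map_add, h, adjoint_mulOp, adjoint_Pplus, adjoint_Pminus, mul_assoc]
  abel

/-- Conjugation negates both exponents, so equality of winding numbers survives passage to the
adjoint. -/
theorem star_fourier_mul_exp (m : ℤ) (a : C(𝕋, ℂ)) :
    star (fourier m * NormedSpace.exp a) = fourier (-m) * NormedSpace.exp (star a) := by
  ext t
  have h : star (Complex.exp (a t)) = Complex.exp (star (a t)) := (Complex.exp_conj _).symm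
  simp only [ContinuousMap.star_apply, ContinuousMap.mul_apply, exp_apply, fourier_neg, star_mul',
    starRingEnd_apply, h]

theorem isWeyl_R_iff (f g φ ψ : C(𝕋, ℂ)) : IsWeyl (R !![f, φ; g, ψ]) ↔ IsWeyl (sio f ψ) := by
  have h := isCompactOperator_R_sub_sio f g φ ψ
  refine ⟨fun hR => hR.congr ?_, fun hs => hs.congr h⟩
  have := h.neg
  rwa [← FunLike.coe_neg, neg_sub] at this

end GSIO

theorem mainTheorem9 (f g φ ψ : C(GSIO.𝕋, ℂ)) :
    IsUnit (GSIO.R !![f, φ; g, ψ]) ↔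
      (IsUnit f ∧ IsUnit ψ) ∧
      GSIO.windingNumber ψ = GSIO.windingNumber f ∧
      ((GSIO.R !![f, φ; g, ψ]).ker = ⊥ ∨
        (ContinuousLinearMap.adjoint (GSIO.R !![f, φ; g, ψ])).ker = ⊥) := by
  constructor
  · intro h
    have hf := GSIO.isUnit_left_of_isUnit_R h
    have hψ := GSIO.isUnit_right_of_isUnit_R h
    refine ⟨⟨hf, hψ⟩, ?_, Or.inl ?_⟩
    · obtain ⟨m, a, hfa, hm⟩ := GSIO.exists_eq_fourier_mul_exp hf
      obtain ⟨n, b, hψb, hn⟩ := GSIO.exists_eq_fourier_mul_exp hψ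
      have hW := (GSIO.isWeyl_R_iff f g φ ψ).1 (GSIO.isWeyl_of_isUnit h)
      rw [hfa, hψb, GSIO.isWeyl_sio_iff] at hW
      rw [hm, hn, hW]
    · exact LinearMap.ker_eq_bot.2 (ContinuousLinearMap.isUnit_iff_bijective.1 h).1
  · rintro ⟨⟨hf, hψ⟩, hw, hker⟩
    obtain ⟨m, a, rfl, hm⟩ := GSIO.exists_eq_fourier_mul_exp hf
    obtain ⟨n, b, rfl, hn⟩ := GSIO.exists_eq_fourier_mul_exp hψ
    rw [hm, hn, Int.cast_inj] at hw
    subst hw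
    rcases hker with hker | hker
    · exact ((GSIO.isWeyl_R_iff _ _ _ _).2 ((GSIO.isWeyl_sio_iff _ _ _ _).2 rfl)).isUnit
        (LinearMap.ker_eq_bot.1 hker)
    · rw [← isUnit_star, ContinuousLinearMap.star_eq_adjoint]
      refine GSIO.IsWeyl.isUnit ?_ (LinearMap.ker_eq_bot.1 hker)
      rw [GSIO.adjoint_R, GSIO.isWeyl_R_iff, GSIO.star_fourier_mul_exp,
        GSIO.star_fourier_mul_exp, GSIO.isWeyl_sio_iff]
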